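/- Let $M$ be a finite monoid that is $\mathscr R$-trivial, i.e. $mM=nM$ implies $m=n$, and let $k$ be any field. Definitions. An ideal of $M$ is a subset $I$ (possibly empty) with $MI\cup IM\subseteq I$; it is prime if $M\setminus I$ is a submonoid. For a principal ideal $X$ put $M_X=\{m\in M : X\subseteq MmM\}$ and ${\uparrow}X=M\setminus M_X$; $X$ is primary if ${\uparrow}X$ is a prime ideal. Let $\Lambda(M)$ be the set of primary ideals, ordered by inclusion, and for $m\in M$ let $\sigma(m)$ be the largest primary ideal contained in $MmM$. For $X\in\Lambda(M)$ let $S_X$ be the one-dimensional left $kM$-module on which $m\in M$ acts as $1$ if $\sigma(m)\ge X$ (equivalently $m\in M_X$) and as $0$ otherwise. A finite-dimensional $k$-algebra $A$ is split if $A/\mathrm{rad}(A)$ is isomorphic to a finite product of matrix algebras over $k$; its quiver $Q(A)$ has as vertices the isomorphism classes of simple left $A$-modules, and the number of arrows from $S$ to $T$ is $\dim_k\mathrm{Ext}^1_A(S,T)$. Theorem. The algebra $kM$ is split over $k$, and $X\mapsto S_X$ induces a bijection from $\Lambda(M)$ onto the vertex set of $Q(kM)$. Let $X,Y\in\Lambda(M)$,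 and let $e_X,e_Y$ be any idempotents with $Me_XM=X$ and $Me_YM=Y$. Let $\equiv$ be the least equivalence relation on $e_YMe_X$ such that (a) $e_Ymne_X\equiv e_Yme_X$ whenever $m,n\in M$, $\sigma(m)\not\ge Y$ and $\sigma(n)\ge X$; (b) $z\equiv z'$ for all $z,z'\in e_YMe_X\cap({\uparrow}Y)({\uparrow}X)$, where $({\uparrow}Y)({\uparrow}X)=\{ab : a\in{\uparrow}Y,\ b\in{\uparrow}X\}$. Let $Z_{X,Y}$ be the set of $\equiv$-classes that contain no element of $({\uparrow}Y)({\uparrow}X)$. Then: (1) if $X$ and $Y$ are incomparable, the number of arrows from $X$ to $Y$ in $Q(kM)$ is $|Z_{X,Y}|$; (2) in all other cases (including $X=Y$), $Z_{X,Y}$ is non-empty and the number of arrows from $X$ to $Y$ in $Q(kM)$ is $|Z_{X,Y}|-1$. -/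

import Mathlib

open CategoryTheory CategoryTheory.Abelian

/-! ### The Gabriel quiver of a split algebra -/

namespace GabrielQuiver

universe u w

section

variable (k : Type u) [Field k] (A : Type w) [Ring A] [Algebra k A]

/-- `A` is split over `k`: the quotient of `A` by its radical is isomorphic, as a `k`-algebra, to a
finite product of (nonempty) matrix algebras over `k`. -/
def IsSplit : Prop :=
  ∃ (r : ℕ) (d : Fin r → ℕ), (∀ i, 0 < d i) ∧
    Nonempty ((A ⧸ Ring.jacobson A) ≃ₐ[k] ((i : Fin r) → Matrix (Fin (d i)) (Fin (d i)) k))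

/-- The simple left `A`-modules. (The universe of `A` is large enough for every simple module,
since each of them is a quotient of `A`.) -/
abbrev SimpleMod : Type (w + 1) := {S : ModuleCat.{w} A // IsSimpleModule A S}

/-- Isomorphism of simple left `A`-modules. -/
instance simpleSetoid : Setoid (SimpleMod A) where
  r S T := Nonempty (S.1 ≅ T.1)
  iseqv :=
    { refl := fun S => ⟨Iso.refl S.1⟩
      symm := fun ⟨f⟩ => ⟨f.symm⟩
      trans := fun ⟨f⟩ ⟨g⟩ => ⟨f ≪≫ g⟩ }

/-- The vertices of the quiver `Q(A)`: the isomorphism classes of simple left `A`-modules. -/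
def Vertex : Type (w + 1) := Quotient (simpleSetoid A)

variable {A}

/-- `dim_k Ext¹_A(S, T)`, as a cardinal. -/
noncomputable def extDim (S T : ModuleCat.{w} A) : Cardinal.{w} :=
  Module.rank k (Ext.{w} S T 1)

theorem extDim_congr {S S' T T' : ModuleCat.{w} A} (f : S ≅ S') (g : T ≅ T') :
    extDim k S T = extDim k S' T' := by
  have e1 : Ext.{w} S T 1 ≃ₗ[k] Ext.{w} S' T 1 :=
    LinearEquiv.ofLinearMap
      ((Ext.mk₀ f.inv).precompOfLinear k T (zero_add 1))
      ((Ext.mk₀ f.hom).precompOfLinear k T (zero_add 1))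
      (by ext x; simp [← Ext.comp_assoc_of_second_deg_zero])
      (by ext x; simp [← Ext.comp_assoc_of_second_deg_zero])
  have e2 : Ext.{w} S' T 1 ≃ₗ[k] Ext.{w} S' T' 1 :=
    LinearEquiv.ofLinearMap
      ((Ext.mk₀ g.hom).postcompOfLinear k S' (add_zero 1))
      ((Ext.mk₀ g.inv).postcompOfLinear k S' (add_zero 1))
      (by ext x; simp)
      (by ext x; simp)
  exact (e1.trans e2).rank_eq

/-- The number of arrows from `V` to `W` in the quiver `Q(A)`: the dimension over `k` of
`Ext¹_A(S, T)`, where `S` and `T` are simple modules in the isomorphism classes `V` and `W`. -/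
noncomputable def arrows (V W : Vertex A) : Cardinal.{w} :=
  Quotient.liftOn₂ V W (fun S T => extDim k S.1 T.1)
    (fun _ _ _ _ ⟨f⟩ ⟨g⟩ => extDim_congr k f g)

end

end GabrielQuiver

/-! ### Principal ideals, primary ideals and the support lattice of a monoid -/

namespace MonoidSupport

universe u w

variable {M : Type w} [Monoid M]

/-- The principal two-sided ideal `MmM`. -/
def principal (m : M) : Set M := {x | ∃ a b : M, x = a * m * b}

/-- `M` is `ℛ`-trivial: `mM = nM` implies `m = n`. -/
def IsRTrivial (M : Type w) [Monoid M] : Prop :=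
  ∀ m n : M, Set.range (fun x => m * x) = Set.range (fun x => n * x) → m = n

/-- A two-sided ideal of a monoid; the empty set is allowed. -/
def IsIdeal (I : Set M) : Prop := ∀ x ∈ I, ∀ a : M, a * x ∈ I ∧ x * a ∈ I

/-- An ideal is prime if its complement is a submonoid. -/
def IsPrime (P : Set M) : Prop :=
  IsIdeal P ∧ ∃ N : Submonoid M, (N : Set M) = Pᶜ

/-- `M_X`, the set of all `m` with `X ⊆ MmM`. -/
def above (X : Set M) : Set M := {m | X ⊆ principal m}

/-- `↑X`, the complement of `M_X`. -/
def nup (X : Set M) : Set M := (above X)ᶜ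

/-- A principal ideal `X` is primary if `↑X` is a prime ideal. -/
def IsPrimary (X : Set M) : Prop := (∃ m : M, X = principal m) ∧ IsPrime (nup X)

/-- `Λ(M)`: the primary ideals of `M`. -/
def Lam (M : Type w) [Monoid M] : Type w := {X : Set M // IsPrimary X}

/-- `Λ(M)` is ordered by inclusion. -/
instance : PartialOrder (Lam M) := inferInstanceAs (PartialOrder {X : Set M // IsPrimary X})

theorem mem_principal_self (m : M) : m ∈ principal m := ⟨1, 1, by simp⟩

theorem principal_subset_iff {m n : M} : principal m ⊆ principal n ↔ m ∈ principal n := by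
  refine ⟨fun h => h (mem_principal_self m), ?_⟩
  rintro ⟨a, b, rfl⟩ x ⟨c, d, rfl⟩
  exact ⟨c * a, b * d, by simp only [mul_assoc]⟩

theorem IsPrimary.mul_mem {X : Set M} (hX : IsPrimary X) {a b : M} (ha : a ∈ above X)
    (hb : b ∈ above X) : a * b ∈ above X := by
  obtain ⟨-, -, N, hN⟩ := hX
  rw [nup, compl_compl] at hN
  rw [← hN] at ha hb ⊢
  exact N.mul_mem ha hb

theorem IsPrimary.one_mem {X : Set M} (hX : IsPrimary X) : (1 : M) ∈ above X := by
  obtain ⟨-, -, N, hN⟩ := hX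
  rw [nup, compl_compl] at hN
  rw [← hN]
  exact N.one_mem

theorem isIdeal_nup (X : Set M) : IsIdeal (nup X) := by
  intro x hx a
  constructor <;> intro h <;> apply hx <;> intro y hy
  · obtain ⟨c, d, rfl⟩ := h hy
    exact ⟨c * a, d, by simp only [mul_assoc]⟩
  · obtain ⟨c, d, rfl⟩ := h hy
    exact ⟨c, a * d, by simp only [mul_assoc]⟩

/-- In a finite monoid, the complement of each submonoid whose complement is an ideal has the form
`↑X` for some primary ideal `X`. -/
theorem exists_primary [Finite M] (N : Submonoid M) (hN : IsIdeal ((N : Set M)ᶜ)) :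
    ∃ j ∈ N, IsPrimary (principal j) ∧ above (principal j) = (N : Set M) := by
  classical
  have key : ∀ s : Finset M, (∀ x ∈ s, x ∈ N) → ∃ j ∈ N, ∀ x ∈ s, j ∈ principal x := by
    intro s
    induction s using Finset.induction_on with
    | empty => exact fun _ => ⟨1, N.one_mem, by simp⟩
    | insert a s ha ih =>
      intro hs
      obtain ⟨j, hj, h⟩ := ih fun x hx => hs x (Finset.mem_insert_of_mem hx)
      refine ⟨a * j, N.mul_mem (hs a (Finset.mem_insert_self a s)) hj, fun x hx => ?_⟩
      rcases Finset.mem_insert.1 hx with rfl | hx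
      · exact ⟨1, j, by simp⟩
      · obtain ⟨c, d, hcd⟩ := h x hx
        exact ⟨a * c, d, by rw [hcd]; simp only [mul_assoc]⟩
  obtain ⟨j, hj, h⟩ := key (Set.toFinite (N : Set M)).toFinset (by simp)
  have hab : above (principal j) = (N : Set M) := by
    ext x
    refine ⟨fun hx => ?_, fun hx => principal_subset_iff.2 (h x (by simpa using hx))⟩
    by_contra hx'
    obtain ⟨a, b, hab⟩ := hx (mem_principal_self j)
    have := (hN _ (hN x hx' a).1 b).2
    rw [← hab] at this
    exact this hj
  exact ⟨j, hj, ⟨⟨j, rfl⟩, isIdeal_nup _, N, by rw [nup, hab, compl_compl]⟩, hab⟩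

/-- There is a largest primary ideal contained in `MmM`. -/
theorem exists_isGreatest [Finite M] (m : M) :
    ∃ P : Lam M, IsGreatest {X : Lam M | X.1 ⊆ principal m} P := by
  let N : Submonoid M :=
    { carrier := {x | ∀ X : Lam M, X.1 ⊆ principal m → x ∈ above X.1}
      one_mem' := fun X _ => X.2.one_mem
      mul_mem' := fun ha hb X hX => X.2.mul_mem (ha X hX) (hb X hX) }
  have hN : IsIdeal ((N : Set M)ᶜ) := by
    intro x hx a
    constructor <;> intro h <;> apply hx <;> intro X hX <;> by_contra hc
    · exact (isIdeal_nup X.1 x hc a).1 (h X hX)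
    · exact (isIdeal_nup X.1 x hc a).2 (h X hX)
  obtain ⟨j, hj, hp, hab⟩ := exists_primary N hN
  refine ⟨⟨principal j, hp⟩, ?_, fun X hX => hj X hX⟩
  have hm : m ∈ (N : Set M) := fun X hX => hX
  rw [← hab] at hm
  exact hm

/-- The support map `σ : M → Λ(M)`: `σ(m)` is the largest primary ideal contained in `MmM`. -/
noncomputable def supp [Finite M] (m : M) : Lam M := Classical.choose (exists_isGreatest m)

theorem isGreatest_supp [Finite M] (m : M) :
    IsGreatest {X : Lam M | X.1 ⊆ principal m} (supp m) :=
  Classical.choose_spec (exists_isGreatest m)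

theorem le_supp_iff [Finite M] (X : Lam M) (m : M) : X ≤ supp m ↔ X.1 ⊆ principal m :=
  ⟨fun h => Set.Subset.trans h (isGreatest_supp m).1, fun h => (isGreatest_supp m).2 h⟩

/-- Each primary ideal of a finite monoid is generated by an idempotent. -/
theorem exists_idempotent_generator [Finite M] (X : Lam M) :
    ∃ e : M, IsIdempotentElem e ∧ principal e = X.1 := by
  obtain ⟨j, hj⟩ := X.2.1
  let _ : TopologicalSpace M := ⊥
  have : DiscreteTopology M := ⟨rfl⟩
  obtain ⟨e, he, hee⟩ := exists_idempotent_in_compact_subsemigroup (M := M)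
    (fun _ => continuous_of_discreteTopology) (above X.1 ∩ X.1)
    ⟨j, by rw [above, Set.mem_ofPred_eq, hj], by rw [hj]; exact mem_principal_self j⟩
    (Set.toFinite _).isCompact (by
      rintro a ⟨ha, ha'⟩ b ⟨hb, -⟩
      refine ⟨X.2.mul_mem ha hb, ?_⟩
      rw [hj] at ha' ⊢
      obtain ⟨c, d, rfl⟩ := ha'
      exact ⟨c, d * b, by simp only [mul_assoc]⟩)
  refine ⟨e, hee, Set.Subset.antisymm ?_ he.1⟩
  have := he.2
  rw [hj] at this ⊢
  exact principal_subset_iff.2 this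

/-! ### The simple module attached to a primary ideal -/

section SimpleModule

variable (k : Type u) [Field k]

open Classical in
/-- The character `M → k` of `X ∈ Λ(M)`: it is `1` on `M_X` and `0` on `↑X`. -/
noncomputable def character (X : Lam M) : M →* k where
  toFun m := if m ∈ above X.1 then 1 else 0
  map_one' := if_pos X.2.one_mem
  map_mul' a b := by
    by_cases ha : a ∈ above X.1
    · by_cases hb : b ∈ above X.1
      · simp [ha, hb, X.2.mul_mem ha hb]
      · have : a * b ∉ above X.1 := (isIdeal_nup X.1 b hb a).1
        simp [hb, this]
    · have : a * b ∉ above X.1 := (isIdeal_nup X.1 a ha b).2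
      simp [ha, this]

/-- The one-dimensional space underlying the simple module `S_X`. -/
def SupportModule (_X : Lam M) : Type (max u w) := ULift.{w} k

noncomputable instance (X : Lam M) : AddCommGroup (SupportModule k X) :=
  inferInstanceAs (AddCommGroup (ULift.{w} k))

/-- `kM` acts on `S_X` through the character of `X`. -/
noncomputable instance (X : Lam M) : Module (MonoidAlgebra k M) (SupportModule k X) :=
  letI : Module k (SupportModule k X) := inferInstanceAs (Module k (ULift.{w} k))
  Module.compHom (SupportModule k X)
    (MonoidAlgebra.lift k k M (character k X) : MonoidAlgebra k M →ₐ[k] k).toRingHom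

variable {k} in
/-- The element of `S_X` with coordinate `c`. -/
def SupportModule.mk (X : Lam M) (c : k) : SupportModule k X := ULift.up c

theorem supportModule_smul (X : Lam M) (a : MonoidAlgebra k M) (c : k) :
    a • SupportModule.mk X c =
      SupportModule.mk X (MonoidAlgebra.lift k k M (character k X) a * c) := rfl

instance (X : Lam M) : IsSimpleModule (MonoidAlgebra k M) (SupportModule k X) := by
  rw [isSimpleModule_iff_toSpanSingleton_surjective]
  refine ⟨inferInstanceAs (Nontrivial (ULift.{w} k)), fun x hx y => ?_⟩
  obtain ⟨c, rfl⟩ : ∃ c, x = SupportModule.mk X c := ⟨ULift.down x, rfl⟩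
  obtain ⟨d, rfl⟩ : ∃ d, y = SupportModule.mk X d := ⟨ULift.down y, rfl⟩
  have hc : c ≠ 0 := fun h => hx (by subst h; rfl)
  refine ⟨algebraMap k (MonoidAlgebra k M) (d / c), ?_⟩
  rw [LinearMap.toSpanSingleton_apply, supportModule_smul, AlgHom.commutes]
  simp [hc]

/-- The vertex of `Q(kM)` given by `X ∈ Λ(M)`: the isomorphism class of `S_X`. -/
noncomputable def vertex (X : Lam M) : GabrielQuiver.Vertex (MonoidAlgebra k M) :=
  Quotient.mk (GabrielQuiver.simpleSetoid (MonoidAlgebra k M))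
    ⟨ModuleCat.of (MonoidAlgebra k M) (SupportModule k X), inferInstance⟩

end SimpleModule

/-! ### The equivalence relation on `fMe` -/

section Relation

variable [Finite M] (X Y : Lam M) (e f : M)

/-- The set `fMe`. -/
def corner (e f : M) : Set M := {z | ∃ m : M, z = f * m * e}

/-- The set product `↑Y↑X`. -/
def nupMul : Set M := {z | ∃ a ∈ nup Y.1, ∃ b ∈ nup X.1, z = a * b}

/-- The pairs generating the equivalence relation on `fMe`:
(a) `fmne ≡ fme` if `σ(m) ≱ Y` and `σ(n) ≥ X`;
(b) `z ≡ z'` if `z` and `z'` are both in `↑Y↑X`. -/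
inductive Gen : corner e f → corner e f → Prop
  | slide (m n : M) (hm : ¬ Y ≤ supp m) (hn : X ≤ supp n) :
      Gen ⟨f * (m * n) * e, m * n, rfl⟩ ⟨f * m * e, m, rfl⟩
  | collapse (z z' : corner e f) (hz : z.1 ∈ nupMul X Y) (hz' : z'.1 ∈ nupMul X Y) : Gen z z'

/-- The least equivalence relation on `fMe` satisfying (a) and (b). -/
def equivRel : Setoid (corner e f) := Relation.EqvGen.setoid (Gen X Y e f)

/-- `Z_{X,Y}`: the classes of `fMe` other than the class of the elements of `↑Y↑X`. (If no element
of `fMe` lies in `↑Y↑X`, these are all the classes.) -/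
def Z : Set (Quotient (equivRel X Y e f)) :=
  {c | ∀ z : corner e f, z.1 ∈ nupMul X Y → Quotient.mk (equivRel X Y e f) z ≠ c}

end Relation

end MonoidSupport

namespace MonoidSupport

universe u w

variable {M : Type w} [Monoid M]

/-! ### Stability and one-dimensionality of the simple modules -/

/-! Write χ_X for the character of X, and e, f for idempotent generators of X, Y. Finiteness and
`ℛ`-triviality give stability: m ∈ MmnM forces mn = m.

On a simple module S, take m acting nontrivially with mM as small as possible. Then each mn either
equals m or kills S. The n with mn = m form some M_X, so the kernel of m is a submodule, hence zero,
and kM acts on S through χ_X. Since distinct characters are linearly independent, kM/rad is a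
product of copies of k indexed by `Lam M`.

The sequence 0 → ker → kM → S_X → 0 identifies Ext¹(S_X, S_Y) with derivations d(mn) = χ_Y(m)d(n) +
d(m)χ_X(n) modulo the span of χ_Y − χ_X, which is a line if X ≠ Y and zero if X = Y.

Derivations are counted on fMe through d(fme) = d(m) + χ_Y(m)d(e) + χ_X(m)d(f). The restriction of d
is a function on Z_{X,Y}, extended by zero on ↑Y↑X. Conversely such a g, together with a = d(e) and
b = d(f), gives a derivation provided a + b = g(fe), χ_Y(e)a = 0 and χ_X(f)b = 0. The derivation
space thus has dimension |Z| + 1, |Z| or |Z| − 1 according as X, Y are incomparable, comparable and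
distinct, or equal; removing the inner derivations leaves |Z|, |Z| − 1, |Z| − 1. -/

theorem mul_eq_of_range_ncard_le [Finite M] (hM : IsRTrivial M) {m n : M}
    (h : (Set.range fun x => m * x).ncard ≤ (Set.range fun x => m * n * x).ncard) :
    m * n = m := by
  refine hM _ _ (Set.eq_of_subset_of_ncard_le ?_ h)
  rintro _ ⟨x, rfl⟩
  exact ⟨n * x, (mul_assoc m n x).symm⟩

/-- If m = a(mn)b, then mM ⊆ a(mnM), so mM has at most as many elements as its subset mnM. -/
theorem mul_eq_of_mem_principal_mul [Finite M] (hM : IsRTrivial M) {m n : M}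
    (h : m ∈ principal (m * n)) : m * n = m := by
  obtain ⟨a, b, hab⟩ := h
  refine mul_eq_of_range_ncard_le hM ((Set.ncard_le_ncard ?_).trans
    (Set.ncard_image_le (f := fun x => a * x) (Set.toFinite _)))
  rintro _ ⟨x, rfl⟩
  refine ⟨m * n * (b * x), ⟨b * x, rfl⟩, ?_⟩
  conv_rhs => rw [hab]
  simp only [mul_assoc]

theorem mem_above_of_principal_eq {X : Set M} {e : M} (he : principal e = X) : e ∈ above X :=
  he.symm.subset

/-- Both e and m lie in the submonoid M_X, so e ∈ X ⊆ MemM and stability applies. The count of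
derivations uses `ℛ`-triviality only through this identity. -/
theorem mul_eq_of_mem_above [Finite M] (hM : IsRTrivial M) (X : Lam M) {e : M}
    (he : principal e = X.1) {m : M} (hm : m ∈ above X.1) : e * m = e := by
  refine mul_eq_of_mem_principal_mul hM ?_
  have := X.2.mul_mem (mem_above_of_principal_eq he) hm
  exact this (he ▸ mem_principal_self e)

theorem mem_above_iff_le {X Y : Lam M} {e : M} (he : principal e = X.1) :
    e ∈ above Y.1 ↔ Y ≤ X := by
  rw [above, Set.mem_ofPred_eq, he]
  rfl

section

variable (k : Type u) [Field k]

/-- The character of the algebra `kM` given by `X ∈ Λ(M)`. -/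
noncomputable abbrev algChar (X : Lam M) : MonoidAlgebra k M →ₐ[k] k :=
  MonoidAlgebra.lift k k M (character k X)

variable {k}

theorem character_of_mem {X : Lam M} {m : M} (h : m ∈ above X.1) : character k X m = 1 :=
  if_pos h

theorem character_of_notMem {X : Lam M} {m : M} (h : m ∉ above X.1) : character k X m = 0 :=
  if_neg h

theorem algChar_of (X : Lam M) (m : M) :
    algChar k X (MonoidAlgebra.of k M m) = character k X m := by
  simp [algChar]

theorem character_injective :
    Function.Injective (character k : Lam M → M →* k) := by
  have key : ∀ {X Y : Lam M}, character k X = character k Y → X ≤ Y := by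
    intro X Y h
    obtain ⟨j, hj⟩ := Y.2.1
    have hjY : j ∈ above Y.1 := hj.subset
    have hjX : j ∈ above X.1 := by
      by_contra hc
      have := DFunLike.congr_fun h j
      rw [character_of_mem hjY, character_of_notMem hc] at this
      exact zero_ne_one this
    exact Set.Subset.trans hjX hj.symm.subset
  exact fun X Y h => le_antisymm (key h) (key h.symm)

/-- Every simple `kM`-module is given by the character of a primary ideal. -/
theorem exists_smul_eq_of_isSimpleModule [Finite M] (hM : IsRTrivial M) (S : Type*)
    [AddCommGroup S] [Module (MonoidAlgebra k M) S] [IsSimpleModule (MonoidAlgebra k M) S] :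
    ∃ X : Lam M, ∀ (a : MonoidAlgebra k M) (s : S),
      a • s = algebraMap k (MonoidAlgebra k M) (algChar k X a) • s := by
  classical
  set o := MonoidAlgebra.of k M
  obtain ⟨m, ⟨t, ht⟩, hmin⟩ := Set.exists_min_image {m : M | ∃ s : S, o m • s ≠ 0}
    (fun m => (Set.range fun x => m * x).ncard) (Set.toFinite _) (by
      have := IsSimpleModule.nontrivial (MonoidAlgebra k M) S
      obtain ⟨s, hs⟩ := exists_ne (0 : S)
      exact ⟨1, s, by simpa using hs⟩)
  have hmn : ∀ n : M, m * n ≠ m → ∀ s : S, o (m * n) • s = 0 := by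
    intro n hn s
    by_contra hs
    exact hn (mul_eq_of_range_ncard_le hM (hmin (m * n) ⟨s, hs⟩))
  let N : Submonoid M :=
    { carrier := {n | m * n = m}
      one_mem' := mul_one m
      mul_mem' := fun {a b} (ha : m * a = m) (hb : m * b = m) => by
        change m * (a * b) = m
        rw [← mul_assoc, ha, hb] }
  -- If a product with n fixes m although some left part p of it has mp ≠ m, then mp kills S, and so
  -- would m, contradicting the choice of t.
  have hN : IsIdeal ((N : Set M)ᶜ) := by
    intro n (hn : m * n ≠ m) a
    constructor
    · intro (h : m * (a * n) = m)
      rw [← mul_assoc] at h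
      have hma : m * a = m := by
        by_contra hc
        apply ht
        have := hmn a hc (o n • t)
        rwa [← mul_smul, ← map_mul, h] at this
      rw [hma] at h
      exact hn h
    · intro (h : m * (n * a) = m)
      apply ht
      have := hmn n hn (o a • t)
      rwa [← mul_smul, ← map_mul, mul_assoc, h] at this
  obtain ⟨j, -, hj, hjN⟩ := exists_primary N hN
  let X : Lam M := ⟨principal j, hj⟩
  have hX : ∀ n, n ∈ above X.1 ↔ m * n = m := fun n => by
    rw [show above X.1 = (N : Set M) from hjN]; rfl
  have hcomm : ∀ (n : M) (c : k) (s : S), o n • algebraMap k (MonoidAlgebra k M) c • s =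
      algebraMap k (MonoidAlgebra k M) c • o n • s := fun n c s => by
    rw [← mul_smul, ← mul_smul, Algebra.commutes]
  have hchar : ∀ (n : M) (s : S), o m • o n • s =
      o m • algebraMap k (MonoidAlgebra k M) (character k X n) • s := by
    intro n s
    rw [← mul_smul, ← map_mul]
    by_cases h : m * n = m
    · rw [character_of_mem ((hX n).2 h), h, map_one, one_smul]
    · rw [character_of_notMem (mt (hX n).1 h), hmn n h, map_zero, zero_smul, smul_zero]
  -- After applying m, each n acts as the scalar χ_X(n), so the kernel of m is stable under kM. By
  -- simplicity it is zero, and m can be cancelled.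
  let K : Submodule (MonoidAlgebra k M) S :=
    { carrier := {s | o m • s = 0}
      zero_mem' := smul_zero _
      add_mem' := fun {a b} (ha : o m • a = 0) (hb : o m • b = 0) => by
        change o m • (a + b) = 0
        rw [smul_add, ha, hb, add_zero]
      smul_mem' := fun a s (hs : o m • s = 0) => by
        change o m • a • s = 0
        induction a using MonoidAlgebra.induction_on with
        | of n => rw [hchar, hcomm, hs, smul_zero]
        | add x y hx hy => rw [add_smul, smul_add, hx, hy, add_zero]
        | smul r x hx => rw [Algebra.smul_def, mul_smul, hcomm, hx, smul_zero] }
  have hK : K = ⊥ := (eq_bot_or_eq_top K).resolve_right fun h =>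
    ht (show t ∈ K from h ▸ Submodule.mem_top)
  refine ⟨X, fun a s => ?_⟩
  induction a using MonoidAlgebra.induction_on with
  | of n =>
    rw [algChar_of, ← sub_eq_zero]
    have : o n • s - algebraMap k (MonoidAlgebra k M) (character k X n) • s ∈ K := by
      change o m • _ = 0
      rw [smul_sub, hchar, sub_self]
    rwa [hK] at this
  | add x y hx hy => rw [add_smul, hx, hy, map_add, map_add, add_smul]
  | smul r x hx =>
    rw [Algebra.smul_def, mul_smul, hx, map_mul, AlgHom.commutes, map_mul, mul_smul]
    rfl

theorem vertex_injective : Function.Injective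
    (vertex k : Lam M → GabrielQuiver.Vertex (MonoidAlgebra k M)) := by
  intro X Y h
  obtain ⟨i⟩ : Nonempty (ModuleCat.of (MonoidAlgebra k M) (SupportModule k X) ≅
      ModuleCat.of (MonoidAlgebra k M) (SupportModule k Y)) := Quotient.exact h
  let e : SupportModule k X ≃ₗ[MonoidAlgebra k M] SupportModule k Y := i.toLinearEquiv
  refine character_injective (k := k) (MonoidHom.ext fun m => ?_)
  obtain ⟨c, hc⟩ : ∃ c, e (.mk X 1) = SupportModule.mk Y c := ⟨_, rfl⟩
  have hc0 : c ≠ 0 := by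
    rintro rfl
    have h0 : SupportModule.mk X (1 : k) = 0 := e.injective (hc.trans (map_zero e).symm)
    exact one_ne_zero (congrArg ULift.down h0)
  have h1 := e.map_smul (MonoidAlgebra.of k M m) (.mk X 1)
  have h2 : MonoidAlgebra.of k M m • SupportModule.mk X (1 : k) =
      algebraMap k (MonoidAlgebra k M) (character k X m) • SupportModule.mk X 1 := by
    rw [supportModule_smul, supportModule_smul, AlgHom.commutes]
    simp
  rw [h2, e.map_smul, hc, supportModule_smul, supportModule_smul, AlgHom.commutes] at h1
  have h3 := congrArg ULift.down h1
  exact mul_right_cancel₀ hc0 (by simpa [SupportModule.mk] using h3)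

theorem vertex_surjective [Finite M] (hM : IsRTrivial M) : Function.Surjective
    (vertex k : Lam M → GabrielQuiver.Vertex (MonoidAlgebra k M)) := by
  intro V
  induction V using Quotient.inductionOn with | h S =>
  obtain ⟨S, hS⟩ := S
  obtain ⟨X, hX⟩ := exists_smul_eq_of_isSimpleModule (k := k) hM S
  refine ⟨X, Quotient.sound ?_⟩
  have := IsSimpleModule.nontrivial (MonoidAlgebra k M) S
  obtain ⟨s, hs⟩ := exists_ne (0 : S)
  let φ : SupportModule k X →ₗ[MonoidAlgebra k M] S :=
    { toFun := fun c => algebraMap k (MonoidAlgebra k M) (ULift.down c) • s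
      map_add' := fun c d => by
        rw [← add_smul, ← map_add]; rfl
      map_smul' := fun a c => by
        rw [RingHom.id_apply, hX a, ← mul_smul, ← map_mul]; rfl }
  have hφ : Function.Bijective φ := LinearMap.bijective_of_ne_zero fun h => hs (by
    have := LinearMap.congr_fun h (SupportModule.mk X 1)
    change algebraMap k (MonoidAlgebra k M) 1 • s = 0 at this
    rwa [map_one, one_smul] at this)
  exact ⟨(LinearEquiv.ofBijective φ hφ).toModuleIso⟩

/-! ### The algebra of an `ℛ`-trivial monoid is split -/

/-- The radical kills each S_X. Conversely, for a maximal left ideal I the quotient kM/I is some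
S_X, so a with all characters zero kills the class of 1 and lies in I. -/
theorem mem_jacobson_iff_algChar_eq_zero [Finite M] (hM : IsRTrivial M) {a : MonoidAlgebra k M} :
    a ∈ Ring.jacobson (MonoidAlgebra k M) ↔ ∀ X : Lam M, algChar k X a = 0 := by
  constructor
  · intro ha X
    have h := Module.le_comap_jacobson
      (LinearMap.toSpanSingleton (MonoidAlgebra k M) (SupportModule k X) (.mk X 1)) ha
    rw [IsSemisimpleModule.jacobson_eq_bot] at h
    have h' : a • SupportModule.mk X (1 : k) = 0 := h
    rw [supportModule_smul, mul_one] at h'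
    exact congrArg ULift.down h'
  · intro ha
    rw [Ring.jacobson_eq_sInf_isMaximal, Ideal.mem_sInf]
    intro I hI
    have : IsSimpleModule (MonoidAlgebra k M) (MonoidAlgebra k M ⧸ I) :=
      isSimpleModule_iff_isCoatom.2 (Ideal.isMaximal_def.1 hI)
    obtain ⟨X, hX⟩ := exists_smul_eq_of_isSimpleModule (k := k) hM (MonoidAlgebra k M ⧸ I)
    have h := hX a (Submodule.Quotient.mk 1)
    rw [ha X, map_zero, zero_smul, ← Submodule.Quotient.mk_smul, smul_eq_mul, mul_one] at h
    exact (Submodule.Quotient.mk_eq_zero I).1 h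

/-- A functional vanishing on the image is a linear relation among the distinct characters of M,
hence zero by Dedekind's lemma. -/
theorem algChar_pi_surjective [Finite M] :
    Function.Surjective (AlgHom.pi (algChar k (M := M))) := by
  have : Finite (Lam M) := Subtype.finite
  have := Fintype.ofFinite (Lam M)
  classical
  set L := AlgHom.pi (algChar k (M := M))
  rw [← AlgHom.coe_toLinearMap, ← LinearMap.range_eq_top]
  by_contra hL
  obtain ⟨f, hf, hLf⟩ := Submodule.exists_le_ker_of_lt_top _ (lt_top_iff_ne_top.2 hL)
  have hli : LinearIndependent k fun X : Lam M => (character k X : M → k) :=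
    (linearIndependent_monoidHom M k).comp _ character_injective
  rw [Fintype.linearIndependent_iff] at hli
  refine hf (LinearMap.pi_ext' fun X => LinearMap.ext_ring ?_)
  refine hli (fun X => f (Pi.single X 1)) (funext fun m => ?_) X
  have h : f (L (MonoidAlgebra.of k M m)) = 0 := hLf ⟨_, rfl⟩
  rw [← Finset.univ_sum_single (L (MonoidAlgebra.of k M m)), map_sum] at h
  rw [Finset.sum_apply, Pi.zero_apply, ← h]
  refine Finset.sum_congr rfl fun X _ => ?_
  have : (Pi.single X (L (MonoidAlgebra.of k M m) X) : Lam M → k) =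
      character k X m • Pi.single X (1 : k) := by
    rw [← Pi.single_smul, smul_eq_mul, mul_one]
    congr 1
    exact algChar_of X m
  rw [this, map_smul, Pi.smul_apply, smul_eq_mul, smul_eq_mul, mul_comm]

theorem nonempty_algEquiv_matrix_one : Nonempty (k ≃ₐ[k] Matrix (Fin 1) (Fin 1) k) := by
  refine ⟨AlgEquiv.ofBijective (Algebra.ofId k (Matrix (Fin 1) (Fin 1) k))
    ⟨(algebraMap k _).injective, fun A => ⟨A 0 0, ?_⟩⟩⟩
  ext i j
  rw [Subsingleton.elim i 0, Subsingleton.elim j 0]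
  simp [Algebra.ofId_apply, Matrix.algebraMap_matrix_apply]

theorem isSplit_monoidAlgebra [Finite M] (hM : IsRTrivial M) :
    GabrielQuiver.IsSplit k (MonoidAlgebra k M) := by
  have : Finite (Lam M) := Subtype.finite
  set L := AlgHom.pi (algChar k (M := M))
  have hker : Ring.jacobson (MonoidAlgebra k M) = RingHom.ker L := by
    ext a
    rw [mem_jacobson_iff_algChar_eq_zero hM, RingHom.mem_ker, funext_iff]
    rfl
  let e := Finite.equivFin (Lam M)
  refine ⟨Nat.card (Lam M), fun _ => 1, fun _ => one_pos, ⟨?_⟩⟩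
  exact ((Ideal.quotientEquivAlgOfEq k hker).trans
    (Ideal.quotientKerAlgEquivOfSurjective algChar_pi_surjective)).trans
    ((AlgEquiv.piCongrLeft k (fun _ => k) e).trans
      (AlgEquiv.piCongrRight fun _ => nonempty_algEquiv_matrix_one.some))

end

/-! ### First extensions and derivations -/

section

variable (k : Type u) [Field k] (X Y : Lam M)

/-- The derivations `M → k` with respect to the characters of `Y` on the left and `X` on the
right. -/
def derivations : Submodule k (M → k) where
  carrier := {d | ∀ m n, d (m * n) = character k Y m * d n + d m * character k X n}
  zero_mem' m n := by simp
  add_mem' {c d} hc hd m n := by simp only [Pi.add_apply, hc m n, hd m n]; ring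
  smul_mem' r d hd m n := by simp only [Pi.smul_apply, smul_eq_mul, hd m n]; ring

/-- The linear map `kM → k` extending `d : M → k`. -/
noncomputable def linearExtension : (M → k) ≃ₗ[k] (MonoidAlgebra k M →ₗ[k] k) :=
  (MonoidAlgebra.basis M k).constr k

variable {k X Y}

@[simp]
theorem linearExtension_of (d : M → k) (m : M) :
    linearExtension k d (MonoidAlgebra.of k M m) = d m :=
  (MonoidAlgebra.basis M k).constr_basis k d m

theorem map_one_of_mem_derivations {d : M → k} (hd : d ∈ derivations k X Y) : d 1 = 0 := by
  simpa using hd 1 1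

theorem linearExtension_mul {d : M → k} (hd : d ∈ derivations k X Y) (a b : MonoidAlgebra k M) :
    linearExtension k d (a * b) =
      algChar k Y a * linearExtension k d b + linearExtension k d a * algChar k X b := by
  induction a using MonoidAlgebra.induction_on with
  | of m =>
    induction b using MonoidAlgebra.induction_on with
    | of n =>
      rw [← map_mul]
      simp only [linearExtension_of, algChar_of]
      exact hd m n
    | add x y hx hy => simp only [mul_add, map_add, hx, hy]; ring
    | smul r x hx => simp only [mul_smul_comm, map_smul, hx, smul_eq_mul]; ring
  | add x y hx hy => simp only [add_mul, map_add, hx, hy]; ring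
  | smul r x hx => simp only [smul_mul_assoc, map_smul, hx, smul_eq_mul]; ring

variable (k X) in
/-- The projection `kM → S_X`. -/
noncomputable def toSupportModule : MonoidAlgebra k M →ₗ[MonoidAlgebra k M] SupportModule k X :=
  LinearMap.toSpanSingleton _ _ (.mk X 1)

theorem toSupportModule_apply (a : MonoidAlgebra k M) :
    toSupportModule k X a = .mk X (algChar k X a) := by
  rw [toSupportModule, LinearMap.toSpanSingleton_apply, supportModule_smul, mul_one]

theorem toSupportModule_surjective : Function.Surjective (toSupportModule k X) := fun c =>
  ⟨algebraMap k _ (ULift.down c), by rw [toSupportModule_apply, AlgHom.commutes]; rfl⟩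

theorem mem_ker_toSupportModule {a : MonoidAlgebra k M} :
    a ∈ LinearMap.ker (toSupportModule k X) ↔ algChar k X a = 0 := by
  rw [LinearMap.mem_ker, toSupportModule_apply]
  exact ⟨congrArg ULift.down, congrArg (SupportModule.mk X)⟩

/-- A derivation restricts to a linear map from the kernel of `kM → S_X` to `S_Y`. -/
noncomputable def kerHom (d : derivations k X Y) :
    LinearMap.ker (toSupportModule k X) →ₗ[MonoidAlgebra k M] SupportModule k Y where
  toFun b := .mk Y (linearExtension k d.1 b.1)
  map_add' b c := congrArg (SupportModule.mk Y) (map_add (linearExtension k d.1) b.1 c.1)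
  map_smul' a b := by
    -- On the kernel χ_X(b) = 0, so the right-hand term of the derivation rule drops out.
    rw [RingHom.id_apply, supportModule_smul, Submodule.coe_smul, smul_eq_mul,
      linearExtension_mul d.2, mem_ker_toSupportModule.1 b.2, mul_zero, add_zero]

variable (k X) in
/-- The short exact sequence `0 → ker → kM → S_X → 0`. -/
noncomputable abbrev augmentation : ShortComplex (ModuleCat.{max u w} (MonoidAlgebra k M)) :=
  (toSupportModule k X).shortComplexKer

theorem augmentation_shortExact : (augmentation k X).ShortExact :=
  LinearMap.shortExact_shortComplexKer toSupportModule_surjective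

instance : Projective (augmentation k X).X₂ :=
  (IsProjective.iff_projective (R := MonoidAlgebra k M) (MonoidAlgebra k M)).1 inferInstance

variable (k X Y) in
/-- `kerHom` as a linear map into the morphisms of modules. -/
noncomputable def kerHomₗ : derivations k X Y →ₗ[k]
    ((augmentation k X).X₁ ⟶ ModuleCat.of (MonoidAlgebra k M) (SupportModule k Y)) where
  toFun d := ModuleCat.ofHom (kerHom d)
  map_add' c d := by
    ext b
    exact congrArg (fun f => SupportModule.mk Y (f b.1)) (map_add (linearExtension k) c.1 d.1)
  map_smul' r d := by
    ext b
    change SupportModule.mk Y (linearExtension k (r • d.1) b.1) =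
      algebraMap k (MonoidAlgebra k M) r • SupportModule.mk Y (linearExtension k d.1 b.1)
    rw [supportModule_smul, AlgHom.commutes, map_smul]
    rfl

/-- As a vector space kM = k·1 ⊕ ker. Extending φ by zero on 1 gives d(m) = φ(m − χ_X(m)·1), which
is a derivation. -/
theorem kerHomₗ_surjective : Function.Surjective (kerHomₗ k X Y) := by
  intro f
  let φ : LinearMap.ker (toSupportModule k X) →ₗ[MonoidAlgebra k M] SupportModule k Y := f.hom
  let o := MonoidAlgebra.of k M
  have hmem : ∀ a, a - algebraMap k _ (algChar k X a) ∈ LinearMap.ker (toSupportModule k X) :=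
    fun a => by rw [mem_ker_toSupportModule, map_sub, AlgHom.commutes]; exact sub_self _
  let p : MonoidAlgebra k M → LinearMap.ker (toSupportModule k X) := fun a => ⟨_, hmem a⟩
  let D : MonoidAlgebra k M →ₗ[k] k :=
    { toFun := fun a => ULift.down (φ (p a))
      map_add' := fun a b => by
        have : p (a + b) = p a + p b := Subtype.ext (by
          change a + b - _ = (a - _) + (b - _)
          rw [map_add, map_add]; abel)
        rw [this, map_add]; rfl
      map_smul' := fun r a => by
        have : p (r • a) = algebraMap k (MonoidAlgebra k M) r • p a := Subtype.ext (by
          change r • a - _ = algebraMap k _ r * (a - _)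
          rw [mul_sub, ← map_mul, Algebra.smul_def, map_mul, AlgHom.commutes]
          rfl)
        rw [this, map_smul]
        change algChar k Y _ * _ = _
        rw [AlgHom.commutes]; rfl }
  have hD : ∀ a b, D (a * b) = algChar k Y a * D b + D a * algChar k X b := by
    intro a b
    have : p (a * b) = a • p b + algebraMap k (MonoidAlgebra k M) (algChar k X b) • p a :=
      Subtype.ext (by
        change a * b - _ = a * (b - _) + algebraMap k _ _ * (a - _)
        rw [mul_sub, mul_sub, Algebra.commutes (algChar k X b) a, map_mul, map_mul,
          Algebra.commutes (algChar k X b) (algebraMap k (MonoidAlgebra k M) (algChar k X a))]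
        abel)
    change ULift.down (φ (p (a * b))) = _
    rw [this, map_add, map_smul, map_smul]
    change algChar k Y a * D b + algChar k Y _ * D a = _
    rw [AlgHom.commutes, mul_comm (D a)]
    rfl
  refine ⟨⟨fun m => D (o m), fun m n => ?_⟩, ?_⟩
  · change D (o (m * n)) = character k Y m * D (o n) + D (o m) * character k X n
    rw [map_mul, hD, algChar_of, algChar_of]
  · have hext : linearExtension k (fun m => D (o m)) = D :=
      (MonoidAlgebra.basis M k).ext fun m => (MonoidAlgebra.basis M k).constr_basis k _ m
    ext b
    change SupportModule.mk Y (linearExtension k (fun m => D (o m)) b.1) = φ b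
    rw [hext]
    have : p b.1 = b := Subtype.ext (by
      change b.1 - _ = _
      rw [mem_ker_toSupportModule.1 b.2, map_zero, sub_zero])
    change φ (p b.1) = φ b
    rw [this]

variable (k X Y) in
/-- The connecting map from derivations to extensions. -/
noncomputable def extOfDerivation : derivations k X Y →ₗ[k]
    Ext.{max u w} (ModuleCat.of (MonoidAlgebra k M) (SupportModule k X))
      (ModuleCat.of (MonoidAlgebra k M) (SupportModule k Y)) 1 :=
  (augmentation_shortExact (k := k) (X := X)).extClass.precompOfLinear k _ (add_zero 1) ∘ₗ
    (Ext.linearEquiv₀ (R := k)).symm.toLinearMap ∘ₗ kerHomₗ k X Y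

theorem extOfDerivation_apply (d : derivations k X Y) : extOfDerivation k X Y d =
    (augmentation_shortExact (k := k) (X := X)).extClass.comp (Ext.mk₀ (kerHomₗ k X Y d))
      (add_zero 1) := rfl

/-- Since kM is projective, Ext¹(kM, S_Y) = 0, so every extension comes from a homomorphism ker →
S_Y. -/
theorem extOfDerivation_surjective : Function.Surjective (extOfDerivation k X Y) := by
  intro x
  obtain ⟨y, hy⟩ := Ext.contravariant_sequence_exact₃ (augmentation_shortExact (k := k) (X := X))
    _ x (Ext.eq_zero_of_projective _) (add_zero 1)
  obtain ⟨f, rfl⟩ := (Ext.linearEquiv₀ (R := k)).symm.surjective y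
  obtain ⟨d, rfl⟩ := kerHomₗ_surjective f
  exact ⟨d, hy⟩

/-- The class vanishes exactly when the map ker → S_Y extends to kM. Such an extension ψ is
determined by c = ψ(1); evaluating it at m − χ_X(m)·1 gives d(m) = c(χ_Y(m) − χ_X(m)). -/
theorem extOfDerivation_eq_zero_iff (d : derivations k X Y) :
    extOfDerivation k X Y d = 0 ↔
      ∃ c : k, d.1 = c • ((character k Y : M → k) - (character k X : M → k)) := by
  rw [extOfDerivation_apply]
  constructor
  · intro h
    obtain ⟨y, hy⟩ := Ext.contravariant_sequence_exact₁ _ _ _ _ h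
    obtain ⟨g, rfl⟩ := (Ext.linearEquiv₀ (R := k)).symm.surjective y
    rw [Ext.linearEquiv₀_symm_apply, Ext.mk₀_comp_mk₀] at hy
    have hg : (augmentation k X).f ≫ g = kerHomₗ k X Y d :=
      (Ext.linearEquiv₀ (R := k)).symm.injective hy
    let ψ : MonoidAlgebra k M →ₗ[MonoidAlgebra k M] SupportModule k Y := g.hom
    refine ⟨ULift.down (ψ 1), funext fun m => ?_⟩
    let b := MonoidAlgebra.of k M m - algebraMap k (MonoidAlgebra k M) (character k X m)
    have hb : b ∈ LinearMap.ker (toSupportModule k X) := by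
      rw [mem_ker_toSupportModule, map_sub, AlgHom.commutes, algChar_of]; exact sub_self _
    have h1 : ψ b = SupportModule.mk Y (linearExtension k d.1 b) :=
      congrArg (fun f => f.hom ⟨b, hb⟩) hg
    have h2 : ψ b = SupportModule.mk Y (algChar k Y b * ULift.down (ψ 1)) := by
      conv_lhs => rw [← mul_one b, ← smul_eq_mul, map_smul]
      rfl
    have h3 : linearExtension k d.1 b = algChar k Y b * ULift.down (ψ 1) :=
      congrArg ULift.down (h1.symm.trans h2)
    rw [map_sub, map_sub, AlgHom.commutes, algChar_of, Algebra.algebraMap_eq_smul_one, map_smul,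
      linearExtension_of, ← map_one (MonoidAlgebra.of k M), linearExtension_of,
      map_one_of_mem_derivations d.2, smul_zero, sub_zero] at h3
    rw [h3, mul_comm]
    rfl
  · rintro ⟨c, hc⟩
    let ψ : MonoidAlgebra k M →ₗ[MonoidAlgebra k M] SupportModule k Y :=
      LinearMap.toSpanSingleton _ _ (.mk Y c)
    have hψ : (augmentation k X).f ≫
        ModuleCat.ofHom ψ = kerHomₗ k X Y d := by
      have hext : linearExtension k d.1 =
          c • ((algChar k Y).toLinearMap - (algChar k X).toLinearMap) := by
        refine (MonoidAlgebra.basis M k).ext fun m => ?_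
        refine ((MonoidAlgebra.basis M k).constr_basis k _ m).trans ?_
        rw [hc]
        change c * (_ - _) = c * (algChar k Y (MonoidAlgebra.of k M m) -
          algChar k X (MonoidAlgebra.of k M m))
        rw [algChar_of, algChar_of]
      ext b
      change b.1 • SupportModule.mk Y c = SupportModule.mk Y (linearExtension k d.1 b.1)
      rw [supportModule_smul, hext]
      change _ = SupportModule.mk Y (c * (algChar k Y b.1 - algChar k X b.1))
      rw [mem_ker_toSupportModule.1 b.2, sub_zero, mul_comm]
    rw [← hψ, ← Ext.mk₀_comp_mk₀]
    exact (augmentation_shortExact (k := k) (X := X)).extClass_comp_assoc _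

open Classical in
theorem finrank_ker_extOfDerivation :
    Module.finrank k (LinearMap.ker (extOfDerivation k X Y)) = if X = Y then 0 else 1 := by
  split_ifs with h
  · subst h
    have : LinearMap.ker (extOfDerivation k X X) = ⊥ := by
      rw [LinearMap.ker_eq_bot']
      intro d hd
      obtain ⟨c, hc⟩ := (extOfDerivation_eq_zero_iff d).1 hd
      exact Subtype.ext (by simpa using hc)
    rw [this, finrank_bot]
  · let i : M → k := (character k Y : M → k) - (character k X : M → k)
    have hi : i ∈ derivations k X Y := fun m n => by
      simp only [i, Pi.sub_apply, map_mul]; ring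
    have hi0 : i ≠ 0 := fun h0 => h (character_injective (k := k)
      (DFunLike.coe_injective (sub_eq_zero.1 h0).symm))
    let j : LinearMap.ker (extOfDerivation k X Y) :=
      ⟨⟨i, hi⟩, (extOfDerivation_eq_zero_iff _).2 ⟨1, (one_smul k i).symm⟩⟩
    refine finrank_eq_one j (fun h0 => hi0 (congrArg (fun z => z.1.1) h0)) fun d => ?_
    obtain ⟨c, hc⟩ := (extOfDerivation_eq_zero_iff d.1).1 d.2
    exact ⟨c, Subtype.ext (Subtype.ext hc.symm)⟩

-- Rank–nullity, in additive form to avoid subtracting cardinals.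
open Classical in
theorem arrows_vertex_add [Finite M] :
    GabrielQuiver.arrows k (vertex k X) (vertex k Y) + ((if X = Y then 0 else 1 : ℕ) : Cardinal) =
      (Module.finrank k (derivations k X Y) : Cardinal.{max u w}) := by
  have := Module.Finite.of_surjective _ (extOfDerivation_surjective (k := k) (X := X) (Y := Y))
  have h := (extOfDerivation k X Y).finrank_range_add_finrank_ker
  rw [LinearMap.range_eq_top.2 extOfDerivation_surjective, finrank_top,
    finrank_ker_extOfDerivation] at h
  rw [← h, Nat.cast_add, Module.finrank_eq_rank]
  rfl

end

/-! ### Derivations and functions on the corner -/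

section

/-- The element `fme` of the corner `fMe`. -/
def toCorner (e f m : M) : corner e f := ⟨f * m * e, m, rfl⟩

theorem toCorner_congr {e f m n : M} (h : f * m * e = f * n * e) :
    toCorner e f m = toCorner e f n := Subtype.ext h

theorem apply_toCorner_mul_of_mem [Finite M] (hM : IsRTrivial M) {Y : Lam M} {e f : M}
    (hf : principal f = Y.1) {α : Type*} (g : corner e f → α) {m : M} (hm : m ∈ above Y.1) (n : M) :
    g (toCorner e f (m * n)) = g (toCorner e f n) := by
  rw [toCorner_congr (n := n) (by rw [← mul_assoc, mul_eq_of_mem_above hM Y hf hm])]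

variable {k : Type u} [Field k] {X Y : Lam M} {e f : M}

theorem character_generator (hf : principal f = Y.1) : character k Y f = 1 :=
  character_of_mem (mem_above_of_principal_eq hf)

/-- Recovers d from its restriction to fMe and the two values d(e), d(f). -/
theorem derivation_apply_toCorner {d : M → k} (hd : d ∈ derivations k X Y)
    (he : principal e = X.1) (hf : principal f = Y.1) (m : M) :
    d (f * m * e) = d m + character k Y m * d e + character k X m * d f := by
  rw [hd, hd, map_mul, character_generator he, character_generator hf]
  ring

theorem derivation_mul_generators {d : M → k} (hd : d ∈ derivations k X Y)
    (he : principal e = X.1) (hf : principal f = Y.1) : d (f * e) = d e + d f := by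
  rw [hd, character_generator he, character_generator hf]
  ring

/-- Here χ_Y(e) = χ_X(e) = 1, so d(e) = d(ee) = 2d(e), which forces d(e) = 0 in every
characteristic. -/
theorem derivation_right_generator {d : M → k} (hd : d ∈ derivations k X Y)
    (hei : IsIdempotentElem e) (he : principal e = X.1) (h : Y ≤ X) : d e = 0 := by
  have := hd e e
  rw [hei.eq, character_generator he, character_of_mem ((mem_above_iff_le he).2 h)] at this
  simpa using this

theorem derivation_left_generator {d : M → k} (hd : d ∈ derivations k X Y)
    (hfi : IsIdempotentElem f) (hf : principal f = Y.1) (h : X ≤ Y) : d f = 0 := by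
  have := hd f f
  rw [hfi.eq, character_generator hf, character_of_mem ((mem_above_iff_le hf).2 h)] at this
  simpa using this

variable [Finite M]

variable (k X Y e f) in
/-- The functions on `fMe` that are constant on the classes of the equivalence relation and vanish
on `↑Y↑X`. -/
def classFunctions : Submodule k (corner e f → k) where
  carrier := {g | (∀ z z', Gen X Y e f z z' → g z = g z') ∧ ∀ z, z.1 ∈ nupMul X Y → g z = 0}
  zero_mem' := ⟨fun _ _ _ => rfl, fun _ _ => rfl⟩
  add_mem' {g h} hg hh :=
    ⟨fun z z' hz => by simp only [Pi.add_apply, hg.1 z z' hz, hh.1 z z' hz],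
      fun z hz => by simp only [Pi.add_apply, hg.2 z hz, hh.2 z hz, add_zero]⟩
  smul_mem' r g hg :=
    ⟨fun z z' hz => by simp only [Pi.smul_apply, hg.1 z z' hz],
      fun z hz => by simp only [Pi.smul_apply, hg.2 z hz, smul_zero]⟩

theorem eq_of_equivRel {g : corner e f → k} (hg : g ∈ classFunctions k X Y e f)
    (z z' : corner e f) (h : (equivRel X Y e f).r z z') : g z = g z' := by
  induction h with
  | rel z z' h => exact hg.1 z z' h
  | refl => rfl
  | symm _ _ _ ih => exact ih.symm
  | trans _ _ _ _ _ ih ih' => exact ih.trans ih'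

variable (k X Y e f) in
open Classical in
/-- Class functions vanishing on `↑Y↑X` are the functions on `Z_{X,Y}`. -/
noncomputable def classFunctionsEquiv : classFunctions k X Y e f ≃ₗ[k] (Z X Y e f → k) where
  toFun g c := Quotient.lift g.1 (eq_of_equivRel g.2) c.1
  map_add' g h := by
    ext ⟨c, hc⟩
    induction c using Quotient.inductionOn
    rfl
  map_smul' r g := by
    ext ⟨c, hc⟩
    induction c using Quotient.inductionOn
    rfl
  invFun h := ⟨fun z => if hz : Quotient.mk (equivRel X Y e f) z ∈ Z X Y e f then h ⟨_, hz⟩ else 0,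
    fun z z' hz => by
      have : Quotient.mk (equivRel X Y e f) z = Quotient.mk (equivRel X Y e f) z' :=
        Quotient.sound (Relation.EqvGen.rel _ _ hz)
      simp only [this],
    fun z hz => dif_neg fun h => h z hz rfl⟩
  left_inv g := by
    ext z
    by_cases hz : Quotient.mk (equivRel X Y e f) z ∈ Z X Y e f
    · exact dif_pos hz
    · refine (dif_neg hz).trans ?_
      simp only [Z, Set.mem_ofPred_eq, not_forall, not_not] at hz
      obtain ⟨z', hz', h⟩ := hz
      rw [← eq_of_equivRel g.2 z' z (Quotient.exact h), g.2.2 z' hz']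
  right_inv h := by
    ext ⟨c, hc⟩
    induction c using Quotient.inductionOn
    exact dif_pos hc

theorem finrank_classFunctions :
    Module.finrank k (classFunctions k X Y e f) = (Z X Y e f).ncard := by
  have := Fintype.ofFinite (Z X Y e f)
  rw [(classFunctionsEquiv k X Y e f).finrank_eq, Module.finrank_fintype_fun_eq_card,
    ← Nat.card_eq_fintype_card]
  rfl

/-- For n ∈ M_X this is relation (a). Otherwise f(mn)e = (fm)(ne) lies in ↑Y↑X, where g vanishes. -/
theorem apply_toCorner_mul_of_notMem {g : corner e f → k} (hg : g ∈ classFunctions k X Y e f)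
    {m : M} (hm : m ∉ above Y.1) (n : M) :
    g (toCorner e f (m * n)) = g (toCorner e f m) * character k X n := by
  by_cases hn : n ∈ above X.1
  · rw [character_of_mem hn, mul_one]
    exact hg.1 _ _ (Gen.slide m n (mt (le_supp_iff Y m).1 hm) ((le_supp_iff X n).2 hn))
  · rw [character_of_notMem hn, mul_zero]
    exact hg.2 _ ⟨f * m, (isIdeal_nup Y.1 m hm f).1, n * e, (isIdeal_nup X.1 n hn e).2,
      show f * (m * n) * e = _ by simp only [mul_assoc]⟩

theorem restrict_mem_classFunctions (he : principal e = X.1) (hf : principal f = Y.1)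
    {d : M → k} (hd : d ∈ derivations k X Y) :
    (fun z : corner e f => d z.1) ∈ classFunctions k X Y e f := by
  have h0 : ∀ z ∈ nupMul X Y, d z = 0 := by
    rintro _ ⟨a, ha, b, hb, rfl⟩
    rw [hd, character_of_notMem ha, character_of_notMem hb]
    ring
  refine ⟨fun z z' h => ?_, fun z hz => h0 _ hz⟩
  cases h with
  | slide m n hm hn =>
    have hm' : character k Y m = 0 := character_of_notMem (mt (le_supp_iff Y m).2 hm)
    have hn' : character k X n = 1 := character_of_mem ((le_supp_iff X n).1 hn)
    change d (f * (m * n) * e) = d (f * m * e)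
    rw [derivation_apply_toCorner hd he hf, derivation_apply_toCorner hd he hf, hd m n, map_mul,
      map_mul, hm', hn']
    ring
  | collapse _ _ hz hz' => exact (h0 _ hz).trans (h0 _ hz').symm

variable (k X Y) in
/-- The restriction of derivations to `fMe`. -/
def restrictDerivation (he : principal e = X.1) (hf : principal f = Y.1) :
    derivations k X Y →ₗ[k] classFunctions k X Y e f where
  toFun d := ⟨fun z => d.1 z.1, restrict_mem_classFunctions he hf d.2⟩
  map_add' _ _ := rfl
  map_smul' _ _ := rfl

theorem derivation_eq_zero (he : principal e = X.1) (hf : principal f = Y.1)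
    {d : derivations k X Y} (hd : restrictDerivation k X Y he hf d = 0) (hde : d.1 e = 0) :
    d = 0 := by
  have h : ∀ m, d.1 (f * m * e) = 0 := fun m =>
    congrFun (congrArg Subtype.val hd) (toCorner e f m)
  have hdf : d.1 f = 0 := by
    have := derivation_mul_generators d.2 he hf
    rwa [← mul_one f, h 1, hde, zero_add, mul_one, eq_comm] at this
  ext m
  have := derivation_apply_toCorner d.2 he hf m
  rw [h m, hde, hdf, mul_zero, mul_zero, add_zero, add_zero] at this
  exact this.symm

/-- A class function extends to a derivation with prescribed values at the two generators. -/
theorem exists_derivation (hM : IsRTrivial M) (hei : IsIdempotentElem e) (he : principal e = X.1)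
    (hfi : IsIdempotentElem f) (hf : principal f = Y.1) (g : classFunctions k X Y e f) (a b : k)
    (hab : a + b = g.1 (toCorner e f 1)) (ha : character k Y e * a = 0)
    (hb : character k X f * b = 0) :
    ∃ d : derivations k X Y, restrictDerivation k X Y he hf d = g ∧ d.1 e = a := by
  -- This is `derivation_apply_toCorner` solved for d(m), with d(e) = a and d(f) = b. The hypotheses
  -- `ha` and `hb` are what ee = e and ff = f impose on these values.
  let d : M → k := fun m => g.1 (toCorner e f m) - character k Y m * a - character k X m * b
  have hd : d ∈ derivations k X Y := by
    intro m n
    simp only [d, map_mul]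
    -- For m ∈ M_Y, fm = f makes g(fme) = g(fe) = a + b; otherwise the class-function relations
    -- apply.
    by_cases hm : m ∈ above Y.1
    · have h1 : g.1 (toCorner e f m) = a + b := by
        rw [hab, ← apply_toCorner_mul_of_mem hM hf g.1 hm 1, mul_one]
      rw [apply_toCorner_mul_of_mem hM hf g.1 hm, h1, character_of_mem hm]
      ring
    · rw [apply_toCorner_mul_of_notMem g.2 hm, character_of_notMem hm]
      ring
  refine ⟨⟨d, hd⟩, Subtype.ext (funext ?_), ?_⟩
  · rintro ⟨_, m, rfl⟩
    change g.1 (toCorner e f (f * m * e)) - character k Y (f * m * e) * a -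
      character k X (f * m * e) * b = g.1 (toCorner e f m)
    rw [toCorner_congr (e := e) (f := f) (m := f * m * e) (n := m) (by
      rw [← mul_assoc, ← mul_assoc, hfi.eq, mul_assoc, hei.eq])]
    simp only [map_mul]
    linear_combination (-character k Y f * character k Y m) * ha -
      (character k X m * character k X e) * hb
  · change g.1 (toCorner e f e) - character k Y e * a - character k X e * b = a
    rw [toCorner_congr (e := e) (f := f) (m := e) (n := 1) (by
      rw [mul_one, mul_assoc, hei.eq]), ← hab, ha, character_generator he]
    ring

/-! ### Dimension of the space of derivations in the three cases -/

/-- Now χ_Y(e) = χ_X(f) = 0, so d(e) is a free parameter and d(f) = g(fe) − d(e). This is the extra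
dimension. -/
theorem finrank_derivations_of_not_comparable (hM : IsRTrivial M) (hei : IsIdempotentElem e)
    (he : principal e = X.1) (hfi : IsIdempotentElem f) (hf : principal f = Y.1)
    (hXY : ¬ X ≤ Y) (hYX : ¬ Y ≤ X) :
    Module.finrank k (derivations k X Y) = (Z X Y e f).ncard + 1 := by
  let φ : derivations k X Y →ₗ[k] classFunctions k X Y e f × k :=
    (restrictDerivation k X Y he hf).prod (LinearMap.proj e ∘ₗ (derivations k X Y).subtype)
  have hφ : Function.Bijective φ := by
    constructor
    · rw [injective_iff_map_eq_zero]
      intro d hd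
      exact derivation_eq_zero he hf (congrArg Prod.fst hd) (congrArg Prod.snd hd)
    · rintro ⟨g, a⟩
      obtain ⟨d, hd, hde⟩ := exists_derivation hM hei he hfi hf g a (g.1 (toCorner e f 1) - a)
        (by ring) (by rw [character_of_notMem (mt (mem_above_iff_le he).1 hYX), zero_mul])
        (by rw [character_of_notMem (mt (mem_above_iff_le hf).1 hXY), zero_mul])
      exact ⟨d, Prod.ext hd hde⟩
  rw [(LinearEquiv.ofBijective φ hφ).finrank_eq, Module.finrank_prod, finrank_classFunctions,
    Module.finrank_self]

/-- Comparability kills d(e) or d(f), and d(fe) = d(e) + d(f) determines the other. -/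
theorem restrictDerivation_injective (hei : IsIdempotentElem e)
    (he : principal e = X.1) (hfi : IsIdempotentElem f) (hf : principal f = Y.1)
    (h : X ≤ Y ∨ Y ≤ X) : Function.Injective (restrictDerivation k X Y he hf) := by
  rw [injective_iff_map_eq_zero]
  intro d hd
  refine derivation_eq_zero he hf hd ?_
  rcases h with h | h
  · have h1 := derivation_mul_generators d.2 he hf
    rw [derivation_left_generator d.2 hfi hf h, add_zero] at h1
    rw [← h1, ← mul_one f]
    exact congrFun (congrArg Subtype.val hd) (toCorner e f 1)
  · exact derivation_right_generator d.2 hei he h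

theorem finrank_derivations_of_comparable (hM : IsRTrivial M) (hei : IsIdempotentElem e)
    (he : principal e = X.1) (hfi : IsIdempotentElem f) (hf : principal f = Y.1)
    (h : X ≤ Y ∨ Y ≤ X) (hne : X ≠ Y) :
    Module.finrank k (derivations k X Y) = (Z X Y e f).ncard := by
  have hφ : Function.Surjective (restrictDerivation k X Y he hf) := by
    intro g
    -- The generator whose value is not forced to vanish takes all of g(fe); X ≠ Y makes the other
    -- character zero on it.
    rcases h with h | h
    · obtain ⟨d, hd, -⟩ := exists_derivation hM hei he hfi hf g (g.1 (toCorner e f 1)) 0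
        (add_zero _) (by
          rw [character_of_notMem (mt (mem_above_iff_le he).1 fun h' => hne (le_antisymm h h')),
            zero_mul]) (mul_zero _)
      exact ⟨d, hd⟩
    · obtain ⟨d, hd, -⟩ := exists_derivation hM hei he hfi hf g 0 (g.1 (toCorner e f 1))
        (zero_add _) (mul_zero _) (by
          rw [character_of_notMem (mt (mem_above_iff_le hf).1 fun h' => hne (le_antisymm h' h)),
            zero_mul])
      exact ⟨d, hd⟩
  rw [(LinearEquiv.ofBijective _
    ⟨restrictDerivation_injective hei he hfi hf h, hφ⟩).finrank_eq, finrank_classFunctions]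

/-- Supplies a class function with value 1 at fe when X = Y, so that evaluation at fe is nonzero. -/
theorem character_mem_classFunctions :
    (fun z : corner e f => character k X z.1) ∈ classFunctions k X X e f := by
  have h0 : ∀ z ∈ nupMul X X, character k X z = 0 := by
    rintro _ ⟨a, ha, b, -, rfl⟩
    rw [map_mul, character_of_notMem ha, zero_mul]
  refine ⟨fun z z' h => ?_, fun z hz => h0 _ hz⟩
  cases h with
  | slide m n hm hn =>
    simp only [map_mul, character_of_notMem (mt (le_supp_iff X m).2 hm), zero_mul, mul_zero]
  | collapse _ _ hz hz' => exact (h0 _ hz).trans (h0 _ hz').symm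

/-- Here d(e) = d(f) = 0, so the restrictions are exactly the class functions with g(fe) = 0, a
hyperplane. In particular Z_{X,X} is nonempty. -/
theorem finrank_derivations_self (hM : IsRTrivial M) (hei : IsIdempotentElem e)
    (he : principal e = X.1) (hfi : IsIdempotentElem f) (hf : principal f = X.1) :
    Module.finrank k (derivations k X X) + 1 = (Z X X e f).ncard := by
  let ev : classFunctions k X X e f →ₗ[k] k :=
    LinearMap.proj (toCorner e f 1) ∘ₗ (classFunctions k X X e f).subtype
  have hev : Function.Surjective ev := LinearMap.surjective fun h0 => by
    have h1 : character k X (f * 1 * e) = 0 :=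
      LinearMap.congr_fun h0 ⟨_, character_mem_classFunctions⟩
    rw [map_mul, map_mul, map_one, character_generator he, character_generator hf] at h1
    simp at h1
  have hrange : LinearMap.range (restrictDerivation k X X he hf) = LinearMap.ker ev := by
    ext g
    constructor
    · rintro ⟨d, rfl⟩
      change d.1 (f * 1 * e) = 0
      rw [mul_one, derivation_mul_generators d.2 he hf,
        derivation_right_generator d.2 hei he le_rfl,
        derivation_left_generator d.2 hfi hf le_rfl, add_zero]
    · intro (hg : g.1 (toCorner e f 1) = 0)
      obtain ⟨d, hd, -⟩ := exists_derivation hM hei he hfi hf g 0 0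
        (by rw [hg, add_zero]) (mul_zero _) (mul_zero _)
      exact ⟨d, hd⟩
  have h := ev.finrank_range_add_finrank_ker
  rw [LinearMap.range_eq_top.2 hev, finrank_top, Module.finrank_self, finrank_classFunctions,
    ← hrange, LinearMap.finrank_range_of_inj
      (restrictDerivation_injective hei he hfi hf (Or.inl le_rfl))] at h
  rw [← h, add_comm]

end

end MonoidSupport

theorem mainTheorem3 (M : Type*) [Monoid M] [Finite M]
    (hM : MonoidSupport.IsRTrivial M) (k : Type*) [Field k] :
    GabrielQuiver.IsSplit k (MonoidAlgebra k M) ∧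
    Function.Bijective
      (MonoidSupport.vertex k :
        MonoidSupport.Lam M → GabrielQuiver.Vertex (MonoidAlgebra k M)) ∧
    ∀ (X Y : MonoidSupport.Lam M) (eX eY : M),
      IsIdempotentElem eX → MonoidSupport.principal eX = X.1 →
      IsIdempotentElem eY → MonoidSupport.principal eY = Y.1 →
      (¬ (X ≤ Y ∨ Y ≤ X) →
        GabrielQuiver.arrows k (MonoidSupport.vertex k X) (MonoidSupport.vertex k Y) =
          ((MonoidSupport.Z X Y eX eY).ncard : Cardinal)) ∧
      ((X ≤ Y ∨ Y ≤ X) →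
        GabrielQuiver.arrows k (MonoidSupport.vertex k X) (MonoidSupport.vertex k Y) + 1 =
          ((MonoidSupport.Z X Y eX eY).ncard : Cardinal)) := by
  refine ⟨MonoidSupport.isSplit_monoidAlgebra hM,
    ⟨MonoidSupport.vertex_injective (k := k), MonoidSupport.vertex_surjective hM⟩,
    fun X Y eX eY hei he hfi hf => ?_⟩
  have key := MonoidSupport.arrows_vertex_add (k := k) (X := X) (Y := Y)
  constructor
  · intro h
    rw [not_or] at h
    rw [if_neg fun hXY => h.1 hXY.le,
      MonoidSupport.finrank_derivations_of_not_comparable hM hei he hfi hf h.1 h.2,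
      Nat.cast_add] at key
    -- The free parameter d(e) cancels against the line of inner derivations; the cancelled cardinal
    -- is finite.
    exact Cardinal.eq_of_add_eq_add_right key (Cardinal.natCast_lt_aleph0)
  · intro h
    by_cases hXY : X = Y
    · subst hXY
      rw [if_pos rfl, Nat.cast_zero, add_zero] at key
      rw [key, ← MonoidSupport.finrank_derivations_self (k := k) hM hei he hfi hf, Nat.cast_add,
        Nat.cast_one]
    · rw [if_neg hXY, Nat.cast_one,
        MonoidSupport.finrank_derivations_of_comparable hM hei he hfi hf h hXY] at key
      exact key
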